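/- Let $\mathbb T=\mathbb R/\mathbb Z$. For an abelian topological group $G$ let $G^\wedge$ be the group of continuous homomorphisms $G\to\mathbb T$ with the compact-open topology, let $G^{\wedge\wedge}=(G^\wedge)^\wedge$, and let $\alpha_G:G\to G^{\wedge\wedge}$ be the canonical homomorphism $\alpha_G(x)(\chi)=\chi(x)$. The group $G$ is called reflexive if $\alpha_G$ is an isomorphism of topological groups. Let $\ell\in\mathbb N$ and let $\mathbf b=(b_n)_{n\ge 0}$ be a sequence of natural numbers such that $b_0=1$, $b_n\ne b_{n+1}$ and $b_n\mid b_{n+1}$ for all $n\ge 0$, and $b_{n+\ell}/b_n\to\infty$ as $n\to\infty$ (that is, $\mathbf b\in\mathcal D_\infty^\ell$). Let $\tau_{\mathbf b}$ be the topology on $\mathbb Z$ of uniform convergence on the set $\{\frac1{b_n}+\mathbb Z:n\ge 0\}\subset\mathbb T$, i.e. the group topology in which the sets $\{x\in\mathbb Z: \frac{x}{b_n}+\mathbb Z\in[-\frac1{4m},\frac1{4m}]+\mathbb Z\text{ for all }n\ge 0\}$, $m\ge 1$, form a neighbourhood basis of $0$, and put $G_\gamma=(\mathbb Z,\tau_{\mathbf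 b})$. Then $\alpha_{G_\gamma}:G_\gamma\to G_\gamma^{\wedge\wedge}$ is a non-surjective embedding: it is continuous, injective and open onto its image, but not surjective. In particular, $G_\gamma$ is not reflexive. -/

import Mathlib

open Filter Topology
open scoped UniformConvergence

noncomputable section

/-- The dual group `G^∧`: continuous homomorphisms from `G` to `𝕋 = ℝ/ℤ` with pointwise addition
and the compact-open topology (both are Mathlib's instances on `G →ₜ+ UnitAddCircle`). -/
abbrev DualGroup (G : Type*) [AddCommGroup G] [TopologicalSpace G] : Type _ :=
  G →ₜ+ UnitAddCircle

/-- The canonical homomorphism `α_G : G → G^∧∧`, `α_G(x)(χ) = χ(x)`. It is not assumed to be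
continuous. -/
def canonicalMap (G : Type*) [AddCommGroup G] [TopologicalSpace G] :
    G →+ DualGroup (DualGroup G) where
  toFun x :=
    { toFun := fun χ => χ x
      map_zero' := rfl
      map_add' := fun _ _ => rfl
      continuous_toFun := ContinuousEvalConst.continuous_eval_const x }
  map_zero' := ContinuousAddMonoidHom.ext fun χ => map_zero χ
  map_add' x y := ContinuousAddMonoidHom.ext fun χ => map_add χ x y

/-- `G` is reflexive if the homomorphism `α_G` is an isomorphism of topological groups. -/
def IsReflexiveGroup (G : Type*) [AddCommGroup G] [TopologicalSpace G] : Prop :=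
  IsHomeomorph (canonicalMap G)

/-- `b` is a `D`-sequence. -/
structure IsDSequence (b : ℕ → ℕ) : Prop where
  zero_eq_one : b 0 = 1
  ne_succ : ∀ n, b n ≠ b (n + 1)
  dvd_succ : ∀ n, b n ∣ b (n + 1)

/-- The set `𝓓_∞^ℓ` of all `D`-sequences `b` with `b_{n+ℓ} / b_n → ∞`. -/
def DInfty (ℓ : ℕ) : Set (ℕ → ℕ) :=
  {b | IsDSequence b ∧ Tendsto (fun n => (b (n + ℓ) : ℝ) / (b n : ℝ)) atTop atTop}

/-- The terms `1 / b_n + ℤ` in `𝕋` of the sequence induced by `b`. -/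
def inducedTerms (b : ℕ → ℕ) : Set UnitAddCircle :=
  Set.range fun n => ((1 / (b n : ℝ) : ℝ) : UnitAddCircle)

/-- Every integer `x` acts on a set `S ⊆ 𝕋` by `ξ ↦ x • ξ`; as a homomorphism from `ℤ` to the
functions `S → 𝕋`, the latter with the structure of uniform convergence. -/
def evalOn (S : Set UnitAddCircle) : ℤ →+ (S →ᵤ UnitAddCircle) where
  toFun x := UniformFun.ofFun fun ξ => x • (ξ : UnitAddCircle)
  map_zero' := by
    apply UniformFun.toFun.injective
    funext ξ
    exact zero_smul ℤ (ξ : UnitAddCircle)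
  map_add' x y := by
    apply UniformFun.toFun.injective
    funext ξ
    exact add_smul x y (ξ : UnitAddCircle)

/-- The topology `τ_b` on `ℤ` of uniform convergence on the sequence `(1 / b_n + ℤ)_n`. -/
abbrev tauTopology (b : ℕ → ℕ) : TopologicalSpace ℤ :=
  TopologicalSpace.induced (evalOn (inducedTerms b)) inferInstance

/-- The group `(ℤ, τ_b)`: a copy of `ℤ` that does not carry the discrete topology of `ℤ`. -/
def TauInt (_b : ℕ → ℕ) : Type := ℤ

instance TauInt.instAddCommGroup (b : ℕ → ℕ) : AddCommGroup (TauInt b) :=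
  inferInstanceAs (AddCommGroup ℤ)

instance TauInt.instTopologicalSpace (b : ℕ → ℕ) : TopologicalSpace (TauInt b) :=
  tauTopology b

/-- `τ_b` is a group topology. -/
instance TauInt.instIsTopologicalAddGroup (b : ℕ → ℕ) : IsTopologicalAddGroup (TauInt b) :=
  topologicalAddGroup_induced (evalOn (inducedTerms b))

end

/-!
The character `χₙ : x ↦ x / bₙ + ℤ` of `(ℤ, τ_b)` is continuous, and the topology `τ_b` is that of
uniform convergence on the set of all `χₙ`.

*Embedding.* The canonical map is continuous for every first countable group, because a convergent
sequence with its limit is compact (`continuous_canonicalMap`). It is injective since an integer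
divisible by all `bₙ` vanishes. It is inducing since the `χₙ` form a null sequence in the dual, so
that `{0} ∪ {χₙ}` is compact and `τ_b` is the topology of uniform convergence on it
(`IsDSequence.tendsto_basicChar`, `IsDSequence.isInducing_canonicalMap`).

*Failure of surjectivity.* As `b_{n+ℓ} / bₙ → ∞`, the ratios `b_{n+1} / bₙ` are unbounded
(`frequently_mul_le_succ`), so there are indices `φ(0) < φ(1) < ⋯` with
`b_{φ(j)+1} ≥ 4^{j+1} b_{φ(j)}`. Then `χ ↦ ∑ⱼ χ(b_{φ(j)})` is an element of the bidual
(`sumBidual`). The reason is that all `2^i b_{φ(j)}` with `i ≤ j` together with `0` form a compact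
set `C` in `(ℤ, τ_b)`, and a bound `‖2^i y‖ ≤ ε ≤ 1 / 4` for all `i ≤ j` implies `‖y‖ ≤ ε / 2^j` in
the circle; hence the sum converges, and it has norm at most `2 ε` if `χ` is bounded by `ε` on `C`.
This element is not the evaluation at an integer `m`: comparing values at `χ_{φ(k)}` shows that `m`
is congruent modulo `b_{φ(k)}` to the partial sum of the first `k` terms `b_{φ(j)}`, which forces
equality for all large `k` (`sumBidual_notMem_range`).
-/

open Set

/-! ### The compact-open topology on dual groups -/

/-- Local uniformity along a filter at every point of a compact set is uniformity on the set. -/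
theorem eventually_forall_mem_of_isCompact {ι X : Type*} [TopologicalSpace X] {l : Filter ι}
    {K : Set X} (hK : IsCompact K) {P : ι → X → Prop}
    (h : ∀ x ∈ K, ∀ᶠ p : ι × X in l ×ˢ 𝓝 x, P p.1 p.2) : ∀ᶠ i in l, ∀ x ∈ K, P i x := by
  simp only [← eventually_iSup, ← hK.prod_nhdsSet_eq_biSup] at h
  exact h.curry.mono fun _ h' => h'.self_of_nhdsSet

/-- Convergence to `0` in the dual group is uniform convergence to `0` on compact sets. -/
theorem tendsto_dualGroup_zero_iff {G ι : Type*} [AddCommGroup G] [TopologicalSpace G]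
    {l : Filter ι} {f : ι → DualGroup G} :
    Tendsto f l (𝓝 0) ↔
      ∀ K : Set G, IsCompact K → ∀ ε > 0, ∀ᶠ i in l, ∀ x ∈ K, ‖f i x‖ < ε := by
  rw [(ContinuousAddMonoidHom.isInducing_toContinuousMap G UnitAddCircle).tendsto_nhds_iff,
    ContinuousMap.tendsto_iff_forall_isCompact_tendstoUniformlyOn]
  refine forall₂_congr fun K _ => ?_
  rw [Metric.tendstoUniformlyOn_iff]
  refine forall₂_congr fun ε _ => eventually_congr (Eventually.of_forall fun i =>
    forall₂_congr fun x _ => ?_)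
  change dist (0 : UnitAddCircle) (f i x) < ε ↔ _
  rw [dist_zero_left]

/-- The canonical map of a first countable group is continuous: a null sequence together with its
limit is a compact set, so it converges to `0` uniformly on each compact set of characters. -/
theorem continuous_canonicalMap (G : Type*) [AddCommGroup G] [TopologicalSpace G]
    [IsTopologicalAddGroup G] [FirstCountableTopology G] : Continuous (canonicalMap G) := by
  refine continuous_of_continuousAt_zero (canonicalMap G) ?_
  rw [ContinuousAt, map_zero]
  refine tendsto_of_seq_tendsto fun u hu => ?_
  rw [tendsto_dualGroup_zero_iff]
  intro K hK ε hε
  have hC : IsCompact (insert 0 (range u)) := hu.isCompact_insert_range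
  have key : ∀ χ₀ ∈ K, ∀ᶠ p : ℕ × DualGroup G in atTop ×ˢ 𝓝 χ₀, ‖p.2 (u p.1)‖ < ε := by
    intro χ₀ _
    have h1 : ∀ᶠ n in atTop, ‖χ₀ (u n)‖ < ε / 2 := by
      have : Tendsto (fun n => ‖χ₀ (u n)‖) atTop (𝓝 0) := by
        simpa using ((χ₀.continuous_toFun.tendsto 0).comp hu).norm
      exact this.eventually_lt_const (half_pos hε)
    have h2 : ∀ᶠ χ in 𝓝 χ₀, ∀ x ∈ insert 0 (range u), ‖(χ - χ₀) x‖ < ε / 2 := by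
      have : Tendsto (fun χ : DualGroup G => χ - χ₀) (𝓝 χ₀) (𝓝 0) := by
        rw [← sub_self χ₀]
        exact tendsto_id.sub_const χ₀
      exact tendsto_dualGroup_zero_iff.1 this _ hC _ (half_pos hε)
    filter_upwards [h1.prod_mk h2] with p hp
    have h3 := hp.2 (u p.1) (mem_insert_of_mem _ (mem_range_self _))
    have h4 : p.2 (u p.1) = (p.2 - χ₀) (u p.1) + χ₀ (u p.1) := by
      change _ = p.2 (u p.1) - χ₀ (u p.1) + χ₀ (u p.1)
      abel
    rw [h4]
    linarith [norm_add_le ((p.2 - χ₀) (u p.1)) (χ₀ (u p.1)), hp.1]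
  exact eventually_forall_mem_of_isCompact hK key

/-! ### The group `(ℤ, τ_b)` and its basic characters -/

/-- The identity of `ℤ`, as an isomorphism onto the copy of `ℤ` with the topology `τ_b`. -/
def TauInt.ofInt (b : ℕ → ℕ) : ℤ ≃+ TauInt b :=
  AddEquiv.refl ℤ

instance TauInt.instFirstCountableTopology (b : ℕ → ℕ) : FirstCountableTopology (TauInt b) :=
  TopologicalSpace.firstCountableTopology_induced ℤ _ (evalOn (inducedTerms b))

/-- The character `x ↦ x / b_n + ℤ` of `(ℤ, τ_b)`. -/
noncomputable def basicChar (b : ℕ → ℕ) (n : ℕ) : DualGroup (TauInt b) where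
  toFun x := (TauInt.ofInt b).symm x • ((1 / (b n : ℝ) : ℝ) : UnitAddCircle)
  map_zero' := by rw [map_zero, zero_smul]
  map_add' x y := by rw [map_add, add_smul]
  continuous_toFun :=
    have h : Continuous fun x : TauInt b => evalOn (inducedTerms b) ((TauInt.ofInt b).symm x) :=
      continuous_induced_dom
    (UniformFun.uniformContinuous_eval UnitAddCircle
      (⟨_, mem_range_self n⟩ : inducedTerms b)).continuous.comp h

theorem basicChar_apply (b : ℕ → ℕ) (n : ℕ) (x : ℤ) :
    basicChar b n (TauInt.ofInt b x) = ((x / b n : ℝ) : UnitAddCircle) := by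
  change x • ((1 / (b n : ℝ) : ℝ) : UnitAddCircle) = _
  rw [← AddCircle.coe_zsmul, zsmul_eq_mul, mul_one_div]

theorem nhds_zero_hasBasis_tauInt (b : ℕ → ℕ) :
    (𝓝 (0 : TauInt b)).HasBasis (0 < ·) fun ε : ℝ => {x | ∀ n, ‖basicChar b n x‖ < ε} := by
  have h := (UniformFun.hasBasis_nhds_zero_of_basis (α := inducedTerms b)
    (Metric.nhds_basis_ball (x := (0 : UnitAddCircle)))).comap (evalOn (inducedTerms b))
  have h0 : 𝓝 (0 : TauInt b) = comap (evalOn (inducedTerms b)) (𝓝 0) := by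
    rw [← map_zero (evalOn (inducedTerms b))]
    exact nhds_induced _ _
  rw [h0]
  refine h.congr (fun _ => Iff.rfl) fun ε _ => Set.ext fun x => ⟨fun H n => ?_, ?_⟩
  · exact mem_ball_zero_iff.1 (H ⟨_, mem_range_self n⟩)
  · rintro H ⟨_, n, rfl⟩
    exact mem_ball_zero_iff.2 (H n)

/-- `x / b_n` is an integer exactly when `b_n` divides `x`. -/
theorem basicChar_eq_zero_iff {b : ℕ → ℕ} {n : ℕ} (hn : 0 < b n) (x : ℤ) :
    basicChar b n (TauInt.ofInt b x) = 0 ↔ (b n : ℤ) ∣ x := by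
  have hn' : (b n : ℝ) ≠ 0 := by positivity
  rw [basicChar_apply, AddCircle.coe_eq_zero_iff]
  refine exists_congr fun k => ?_
  rw [zsmul_eq_mul, mul_one, eq_div_iff hn', eq_comm, mul_comm]
  exact_mod_cast Iff.rfl

theorem norm_basicChar_le (b : ℕ → ℕ) (n : ℕ) (x : ℤ) :
    ‖basicChar b n (TauInt.ofInt b x)‖ ≤ |(x : ℝ)| / b n := by
  rw [basicChar_apply]
  refine (QuotientAddGroup.norm_mk_le_norm).trans ?_
  rw [Real.norm_eq_abs, abs_div, Nat.abs_cast]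

namespace IsDSequence

variable {b : ℕ → ℕ}

theorem pos (hb : IsDSequence b) (n : ℕ) : 0 < b n := by
  -- a term `0` would force its successor to be `0`, that is, equal to it
  refine Nat.pos_of_ne_zero fun h => hb.ne_succ n ?_
  have := hb.dvd_succ n
  rw [h, zero_dvd_iff] at this
  rw [h, this]

protected theorem strictMono (hb : IsDSequence b) : StrictMono b :=
  strictMono_nat_of_lt_succ fun n =>
    lt_of_le_of_ne (Nat.le_of_dvd (hb.pos _) (hb.dvd_succ n)) (hb.ne_succ n)

protected theorem dvd (hb : IsDSequence b) {m n : ℕ} (h : m ≤ n) : b m ∣ b n := by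
  induction h with
  | refl => exact dvd_rfl
  | step _ ih => exact ih.trans (hb.dvd_succ _)

/-- The basic characters form a null sequence in the dual group: they are equicontinuous and
converge to `0` pointwise. -/
theorem tendsto_basicChar (hb : IsDSequence b) : Tendsto (basicChar b) atTop (𝓝 0) := by
  rw [tendsto_dualGroup_zero_iff]
  intro K hK ε hε
  have key : ∀ x₀ ∈ K, ∀ᶠ p : ℕ × TauInt b in atTop ×ˢ 𝓝 x₀, ‖basicChar b p.1 p.2‖ < ε := by
    intro x₀ _
    have h1 : ∀ᶠ n in atTop, ‖basicChar b n x₀‖ < ε / 2 := by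
      obtain ⟨m, rfl⟩ := (TauInt.ofInt b).surjective x₀
      have hlim : Tendsto (fun n => |(m : ℝ)| / (b n : ℝ)) atTop (𝓝 0) :=
        (tendsto_natCast_atTop_atTop.comp hb.strictMono.tendsto_atTop).const_div_atTop _
      exact (hlim.eventually_lt_const (half_pos hε)).mono fun n hn =>
        (norm_basicChar_le b n m).trans_lt hn
    have h2 : ∀ᶠ x in 𝓝 x₀, ∀ n, ‖basicChar b n (x - x₀)‖ < ε / 2 := by
      have : Tendsto (fun x : TauInt b => x - x₀) (𝓝 x₀) (𝓝 0) := by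
        rw [← sub_self x₀]
        exact tendsto_id.sub_const x₀
      exact this.eventually ((nhds_zero_hasBasis_tauInt b).mem_of_mem (half_pos hε))
    filter_upwards [h1.prod_mk h2] with p hp
    have h4 : basicChar b p.1 p.2 = basicChar b p.1 (p.2 - x₀) + basicChar b p.1 x₀ := by
      rw [← map_add, sub_add_cancel]
    rw [h4]
    linarith [norm_add_le (basicChar b p.1 (p.2 - x₀)) (basicChar b p.1 x₀), hp.1, hp.2 p.1]
  exact eventually_forall_mem_of_isCompact hK key

theorem injective_canonicalMap (hb : IsDSequence b) :
    Function.Injective (canonicalMap (TauInt b)) := by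
  rw [injective_iff_map_eq_zero]
  intro x hx
  obtain ⟨m, rfl⟩ := (TauInt.ofInt b).surjective x
  have hdvd (n : ℕ) : (b n : ℤ) ∣ m :=
    (basicChar_eq_zero_iff (hb.pos n) m).1 (DFunLike.congr_fun hx (basicChar b n))
  have hm : m = 0 := by
    refine Int.eq_zero_of_abs_lt_dvd (hdvd (m.natAbs + 1)) ?_
    rw [Int.abs_eq_natAbs]
    have := hb.strictMono.le_apply (x := m.natAbs + 1)
    omega
  rw [hm, map_zero]

/-- A basic neighbourhood of `0` in `(ℤ, τ_b)` is the trace of a neighbourhood of `0` in the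
bidual, because the basic characters together with `0` form a compact set of characters. -/
theorem isInducing_canonicalMap (hb : IsDSequence b) :
    IsInducing (canonicalMap (TauInt b)) := by
  rw [IsTopologicalAddGroup.isInducing_iff_nhds_zero]
  refine le_antisymm ?_ ((nhds_zero_hasBasis_tauInt b).ge_iff.2 fun ε hε => ?_)
  · rw [← tendsto_iff_comap, ← map_zero (canonicalMap (TauInt b))]
    exact (continuous_canonicalMap (TauInt b)).tendsto 0
  · have h : {ψ : DualGroup (DualGroup (TauInt b)) |
        ∀ χ ∈ insert 0 (range (basicChar b)), ‖ψ χ‖ < ε} ∈ 𝓝 0 :=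
      tendsto_dualGroup_zero_iff.1 tendsto_id _ hb.tendsto_basicChar.isCompact_insert_range ε hε
    exact mem_of_superset (preimage_mem_comap h) fun x hx n =>
      hx (basicChar b n) (mem_insert_of_mem _ (mem_range_self n))

end IsDSequence

/-! ### An element of the bidual that is not an evaluation -/

/-- On the ball of radius `1 / 4` of the circle, doubling doubles the norm. -/
theorem norm_two_nsmul_unitAddCircle {y : UnitAddCircle} (hy : ‖y‖ ≤ 1 / 4) :
    ‖2 • y‖ = 2 * ‖y‖ := by
  obtain ⟨r, rfl⟩ := QuotientAddGroup.mk_surjective y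
  -- the representative of least absolute value
  have hr : ‖((r : ℝ) : UnitAddCircle)‖ = |r - round r| := UnitAddCircle.norm_eq
  have hcoe : ((r : ℝ) : UnitAddCircle) = ((r - round r : ℝ) : UnitAddCircle) := by
    rw [AddCircle.coe_sub, eq_comm, sub_eq_self, AddCircle.coe_eq_zero_iff]
    exact ⟨round r, by simp⟩
  change ‖2 • ((r : ℝ) : UnitAddCircle)‖ = 2 * ‖((r : ℝ) : UnitAddCircle)‖
  change ‖((r : ℝ) : UnitAddCircle)‖ ≤ 1 / 4 at hy
  rw [hr] at hy ⊢
  rw [hcoe, ← AddCircle.coe_nsmul, (AddCircle.norm_coe_eq_abs_iff 1 one_ne_zero).2,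
    nsmul_eq_mul, abs_mul] <;> simp [abs_mul]
  linarith

/-- If `y, 2y, 4y, …, 2^j y` all lie in a ball of radius at most `1 / 4`, then `y` lies in the ball
whose radius is smaller by the factor `2^j`. -/
theorem norm_le_of_forall_two_pow_nsmul {y : UnitAddCircle} {ε : ℝ} (hε : ε ≤ 1 / 4) {j : ℕ}
    (h : ∀ i ≤ j, ‖2 ^ i • y‖ ≤ ε) : ‖y‖ ≤ ε * (1 / 2) ^ j := by
  have key : ∀ i ≤ j, ‖2 ^ i • y‖ = 2 ^ i * ‖y‖ := by
    intro i hi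
    induction i with
    | zero => simp
    | succ i ih =>
      rw [pow_succ', mul_nsmul', norm_two_nsmul_unitAddCircle ((h i (by omega)).trans hε),
        ih (by omega), pow_succ', mul_assoc]
  have := h j le_rfl
  rw [key j le_rfl] at this
  rw [one_div, inv_pow, ← div_eq_mul_inv, le_div_iff₀ (by positivity), mul_comm]
  exact this

/-- If `b_{n+ℓ} / b_n → ∞`, then the ratios `b_{n+1} / b_n` are unbounded: a bound `M` on them from
some point on would give the bound `M ^ ℓ` for `b_{n+ℓ} / b_n`. -/
theorem frequently_mul_le_succ {ℓ : ℕ} {b : ℕ → ℕ} (hb : b ∈ DInfty ℓ) (M : ℕ) :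
    ∃ᶠ n in atTop, M * b n ≤ b (n + 1) := by
  intro h
  obtain ⟨N, hN⟩ := eventually_atTop.1 h
  have hpow : ∀ k, ∀ n ≥ N, b (n + k) ≤ M ^ k * b n := by
    intro k
    induction k with
    | zero => simp
    | succ k ih =>
      intro n hn
      calc b (n + k + 1) ≤ M * b (n + k) := (not_le.1 (hN (n + k) (by omega))).le
        _ ≤ M * (M ^ k * b n) := Nat.mul_le_mul_left _ (ih n hn)
        _ = M ^ (k + 1) * b n := by ring
  obtain ⟨n, hnN, hn⟩ := ((eventually_ge_atTop N).and
    (hb.2.eventually_gt_atTop ((M : ℝ) ^ ℓ))).exists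
  rw [lt_div_iff₀ (by exact_mod_cast hb.1.pos n)] at hn
  have := hpow ℓ n hnN
  have : (b (n + ℓ) : ℝ) ≤ (M : ℝ) ^ ℓ * b n := by exact_mod_cast this
  linarith

section Bidual

variable {b : ℕ → ℕ} {φ : ℕ → ℕ}

/-- The set of all `2^i b_{φ(j)}` with `i ≤ j`, together with `0`. -/
def testSet (b φ : ℕ → ℕ) : Set (TauInt b) :=
  insert 0 (range fun p : {p : ℕ × ℕ // p.2 ≤ p.1} =>
    2 ^ p.1.2 • (TauInt.ofInt b (b (φ p.1.1))))

theorem mem_testSet {i j : ℕ} (h : i ≤ j) :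
    2 ^ i • (TauInt.ofInt b (b (φ j))) ∈ testSet b φ :=
  mem_insert_of_mem _ ⟨⟨(j, i), h⟩, rfl⟩

/-- The bound `b_{φ(j)+1} / b_{φ(j)} ≥ 4^{j+1}` makes all multiples `2^i b_{φ(j)}`, `i ≤ j`, small:
modulo `1`, their quotients by `b_n` are `0` for `n ≤ φ(j)` and at most `2^i / 4^{j+1}` otherwise. -/
theorem norm_basicChar_two_pow_nsmul_le (hb : IsDSequence b)
    (hq : ∀ j, 4 ^ (j + 1) * b (φ j) ≤ b (φ j + 1)) {i j : ℕ} (h : i ≤ j) (n : ℕ) :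
    ‖basicChar b n (2 ^ i • (TauInt.ofInt b (b (φ j))))‖ ≤ (1 / 2) ^ j := by
  obtain hn | hn := le_or_gt n (φ j)
  · rw [map_nsmul, (basicChar_eq_zero_iff (hb.pos n) _).2 (by exact_mod_cast hb.dvd hn)]
    simp
  · have hx : 2 ^ i • (TauInt.ofInt b (b (φ j))) =
        TauInt.ofInt b ((2 ^ i * b (φ j) : ℕ) : ℤ) := by
      change (2 ^ i : ℕ) • (b (φ j) : ℤ) = ((2 ^ i * b (φ j) : ℕ) : ℤ)
      simp
    rw [hx]
    refine (norm_basicChar_le b n _).trans ?_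
    have hbn : (0 : ℝ) < b n := by exact_mod_cast hb.pos n
    have h1 : (4 : ℝ) ^ j * b (φ j) ≤ b n := by
      have : 4 ^ j * b (φ j) ≤ 4 ^ (j + 1) * b (φ j) := by gcongr <;> omega
      exact_mod_cast (this.trans (hq j)).trans (hb.strictMono.monotone hn)
    have h2 : (2 : ℝ) ^ i ≤ 2 ^ j := pow_le_pow_right₀ one_le_two h
    have h3 : (4 : ℝ) ^ j * (1 / 2) ^ j = 2 ^ j := by rw [← mul_pow]; norm_num
    rw [div_le_iff₀ hbn, Int.cast_natCast, Nat.abs_cast]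
    push_cast
    calc (2 : ℝ) ^ i * b (φ j) ≤ 2 ^ j * b (φ j) := by gcongr
      _ = (1 / 2) ^ j * (4 ^ j * b (φ j)) := by rw [← h3]; ring
      _ ≤ (1 / 2) ^ j * b n := by gcongr

theorem isCompact_testSet (hb : IsDSequence b) (hq : ∀ j, 4 ^ (j + 1) * b (φ j) ≤ b (φ j + 1)) :
    IsCompact (testSet b φ) := by
  refine Tendsto.isCompact_insert_range_of_cofinite
    ((nhds_zero_hasBasis_tauInt b).tendsto_right_iff.2 fun ε hε => ?_)
  obtain ⟨J, hJ⟩ := exists_pow_lt_of_lt_one hε (one_half_lt_one (α := ℝ))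
  -- the exceptional pairs `(j, i)` satisfy `i ≤ j < J`
  have hfin : {p : {p : ℕ × ℕ // p.2 ≤ p.1} | p.1.1 < J}.Finite := by
    refine Finite.of_finite_image (f := Subtype.val)
      (((finite_Iio J).prod (finite_Iio J)).subset ?_) Subtype.val_injective.injOn
    rintro _ ⟨⟨⟨j, i⟩, h⟩, hp, rfl⟩
    exact ⟨hp, lt_of_le_of_lt h hp⟩
  filter_upwards [hfin.compl_mem_cofinite] with p hp n
  have hp : J ≤ p.1.1 := not_lt.1 hp
  exact ((norm_basicChar_two_pow_nsmul_le hb hq p.2 n).trans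
    (pow_le_pow_of_le_one (by norm_num) (by norm_num) hp)).trans_lt hJ

/-- Every character is small on `2^i b_{φ(j)}`, `i ≤ j`, for large `j`, hence is of size at most
`2^{-j}` at `b_{φ(j)}`. -/
theorem summable_character (hb : IsDSequence b) (hq : ∀ j, 4 ^ (j + 1) * b (φ j) ≤ b (φ j + 1))
    (χ : DualGroup (TauInt b)) :
    Summable fun j => χ (TauInt.ofInt b (b (φ j))) := by
  have hχ : ∀ᶠ x in 𝓝 (0 : TauInt b), ‖χ x‖ < 1 / 4 := by
    have : Tendsto (fun x => ‖χ x‖) (𝓝 0) (𝓝 0) := by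
      simpa using (χ.continuous_toFun.tendsto 0).norm
    exact this.eventually_lt_const (by norm_num)
  obtain ⟨ε, hε, hU⟩ := (nhds_zero_hasBasis_tauInt b).eventually_iff.1 hχ
  obtain ⟨J, hJ⟩ := exists_pow_lt_of_lt_one hε (one_half_lt_one (α := ℝ))
  refine Summable.of_norm_bounded_eventually_nat
    (g := fun j => 1 / 4 * (1 / 2 : ℝ) ^ j) (summable_geometric_two.mul_left _) ?_
  filter_upwards [eventually_ge_atTop J] with j hj
  refine norm_le_of_forall_two_pow_nsmul le_rfl fun i hi => ?_
  rw [← map_nsmul]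
  exact (hU fun n => ((norm_basicChar_two_pow_nsmul_le hb hq hi n).trans
    (pow_le_pow_of_le_one (by norm_num) (by norm_num) hj)).trans_lt hJ).le

/-- The element `χ ↦ ∑ⱼ χ(b_{φ(j)})` of the bidual: evaluation at the "integer" `∑ⱼ b_{φ(j)}`,
which is missing from `ℤ`. It is continuous because a character that is small on the compact set
`testSet b φ` is so small at `b_{φ(j)}` that the sum remains small. -/
noncomputable def sumBidual (hb : IsDSequence b) (hq : ∀ j, 4 ^ (j + 1) * b (φ j) ≤ b (φ j + 1)) :
    DualGroup (DualGroup (TauInt b)) :=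
  let f : DualGroup (TauInt b) →+ UnitAddCircle :=
    { toFun := fun χ => ∑' j, χ (TauInt.ofInt b (b (φ j)))
      map_zero' := tsum_zero
      map_add' := fun χ χ' =>
        (summable_character hb hq χ).tsum_add (summable_character hb hq χ') }
  { f with
    continuous_toFun := by
      refine continuous_of_continuousAt_zero f ?_
      rw [ContinuousAt, map_zero, Metric.nhds_basis_ball.tendsto_right_iff]
      intro ε hε
      have hδ : 0 < min (1 / 4) (ε / 4) := by positivity
      filter_upwards [tendsto_dualGroup_zero_iff.1 (tendsto_id (α := DualGroup (TauInt b))) _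
        (isCompact_testSet hb hq) _ hδ] with χ hχ
      rw [mem_ball_zero_iff]
      have hbound (j : ℕ) : ‖χ (TauInt.ofInt b (b (φ j)))‖ ≤ ε / 4 * (1 / 2) ^ j :=
        (norm_le_of_forall_two_pow_nsmul (min_le_left _ _) fun i hi => by
          rw [← map_nsmul]; exact (hχ _ (mem_testSet hi)).le).trans
            (by gcongr; exact min_le_right _ _)
      have := tsum_of_norm_bounded (hasSum_geometric_two.mul_left (ε / 4)) hbound
      exact this.trans_lt (by linarith) }

/-- At a basic character `x ↦ x / b_{φ(k)}` the sum is finite, as `b_{φ(k)}` divides `b_{φ(j)}`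
for `j ≥ k`. -/
theorem sumBidual_basicChar (hb : IsDSequence b) (hq : ∀ j, 4 ^ (j + 1) * b (φ j) ≤ b (φ j + 1))
    (hφ : StrictMono φ) (k : ℕ) :
    sumBidual hb hq (basicChar b (φ k)) =
      basicChar b (φ k) (TauInt.ofInt b (∑ j ∈ Finset.range k, (b (φ j) : ℤ))) := by
  change ∑' j, basicChar b (φ k) (TauInt.ofInt b (b (φ j))) = _
  rw [tsum_eq_sum (s := Finset.range k)]
  · exact (map_sum (basicChar b (φ k)) (fun j => (TauInt.ofInt b (b (φ j)))) _).symm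
  · intro j hj
    refine (basicChar_eq_zero_iff (hb.pos _) _).2 ?_
    exact_mod_cast hb.dvd (hφ.monotone (by simpa using hj))

/-- If evaluation at an integer `x` agreed with the sum, `x` would be congruent modulo `b_{φ(k)}` to
the partial sum `∑_{j<k} b_{φ(j)}`, hence equal to it for all large `k`; but these partial sums are
strictly increasing. -/
theorem sumBidual_notMem_range (hb : IsDSequence b) (hq : ∀ j, 4 ^ (j + 1) * b (φ j) ≤ b (φ j + 1))
    (hφ : StrictMono φ) : sumBidual hb hq ∉ range (canonicalMap (TauInt b)) := by
  rintro ⟨x, hx⟩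
  obtain ⟨m, rfl⟩ := (TauInt.ofInt b).surjective x
  set S : ℕ → ℤ := fun k => ∑ j ∈ Finset.range k, (b (φ j) : ℤ) with hS
  have hS0 (k : ℕ) : 0 ≤ S k := Finset.sum_nonneg fun _ _ => by positivity
  have hSsucc (k : ℕ) : S (k + 1) = S k + b (φ k) := Finset.sum_range_succ _ _
  have hdvd (k : ℕ) : (b (φ k) : ℤ) ∣ m - S k := by
    refine (basicChar_eq_zero_iff (hb.pos _) _).1 ?_
    rw [map_sub, map_sub, sub_eq_zero]
    exact (DFunLike.congr_fun hx (basicChar b (φ k))).trans (sumBidual_basicChar hb hq hφ k)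
  -- as `b_{φ(k+1)} ≥ 4 b_{φ(k)}`, the partial sums stay below a third of the modulus
  have hthird (k : ℕ) : 3 * S k ≤ b (φ k) := by
    induction k with
    | zero => simp [hS]
    | succ k ih =>
      have h1 : 4 * b (φ k) ≤ 4 ^ (k + 1) * b (φ k) :=
        Nat.mul_le_mul_right _ (Nat.le_self_pow (by omega) 4)
      have h2 := hb.strictMono.monotone (show φ k + 1 ≤ φ (k + 1) from hφ (Nat.lt_succ_self k))
      have h3 := hq k
      rw [hSsucc]
      omega
  have heq (k : ℕ) (hk : 2 * m.natAbs < k) : m = S k := by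
    refine sub_eq_zero.1 (Int.eq_zero_of_abs_lt_dvd (hdvd k) (abs_lt.2 ?_))
    have h1 := hφ.le_apply (x := k)
    have h2 := hb.strictMono.le_apply (x := φ k)
    have h3 := hthird k
    have h4 := hS0 k
    constructor <;> omega
  have h1 := heq (2 * m.natAbs + 1) (by omega)
  have h2 := heq (2 * m.natAbs + 1 + 1) (by omega)
  have h3 := hSsucc (2 * m.natAbs + 1)
  have h4 := hb.pos (φ (2 * m.natAbs + 1))
  omega

end Bidual

/-- For `b ∈ 𝓓_∞^ℓ` the canonical map of `(ℤ, τ_b)` into its bidual is continuous, injective and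
open onto its image, but not surjective; hence `(ℤ, τ_b)` is not reflexive. -/
theorem mainTheorem5 (ℓ : ℕ) (b : ℕ → ℕ) (hb : b ∈ DInfty ℓ) :
    Continuous (canonicalMap (TauInt b)) ∧
    Function.Injective (canonicalMap (TauInt b)) ∧
    IsOpenMap (Set.rangeFactorization (canonicalMap (TauInt b))) ∧
    ¬ Function.Surjective (canonicalMap (TauInt b)) ∧
    ¬ IsReflexiveGroup (TauInt b) := by
  have hind := hb.1.isInducing_canonicalMap
  have hsurj : ¬ Function.Surjective (canonicalMap (TauInt b)) := by
    obtain ⟨φ, hφ, hq⟩ := extraction_forall_of_frequently fun j =>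
      frequently_mul_le_succ hb (4 ^ (j + 1))
    exact fun h => sumBidual_notMem_range hb.1 hq hφ (h _)
  refine ⟨hind.continuous, hb.1.injective_canonicalMap, ?_, hsurj, fun h => hsurj h.surjective⟩
  have hind' : IsInducing (rangeFactorization (canonicalMap (TauInt b))) :=
    .of_comp (hind.continuous.subtype_mk _) continuous_subtype_val hind
  exact hind'.isOpenMap (by rw [rangeFactorization_surjective.range_eq]; exact isOpen_univ)
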